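/- Call a zero $\rho$ of the Riemann zeta function $\zeta$ non-trivial if $0<\operatorname{Re}\rho<1$, write $\rho=\tfrac12+\delta_\rho+i\beta_\rho$ with $\delta_\rho,\beta_\rho\in\mathbb{R}$, and let $m_\rho$ be its multiplicity as a zero of $\zeta$. Let $\Omega_1$ be the set of non-trivial zeros with $\delta_\rho=0$ and $\beta_\rho>0$, and let $\Omega_2$ be the (possibly empty) set of non-trivial zeros with $\delta_\rho>0$ and $\beta_\rho>0$. Then the two series $$\lambda=\sum_{\rho\in\Omega_1}\frac{m_\rho}{\left(\frac12\right)^2+\beta_\rho^2},\qquad \mu=\sum_{\rho\in\Omega_2}\frac{m_\rho\left(\frac12-2\delta_\rho^2+2\beta_\rho^2\right)}{\left(\left(\frac12+\delta_\rho\right)^2+\beta_\rho^2\right)\left(\left(\frac12-\delta_\rho\right)^2+\beta_\rho^2\right)}$$ converge (absolutely), and $$\lambda+\mu=1+\frac{\gamma}{2}-\frac12\log(4\pi),$$ where $\gamma$ is the Euler–Mascheroni constant. -/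

import Mathlib

noncomputable section

/-- The non-trivial zeros of the Riemann zeta function: its zeros
`ρ = 1/2 + δ + iβ` with `-1/2 < δ < 1/2`, i.e. in the open critical strip. -/
def nontrivialZeros : Set ℂ :=
  {ρ : ℂ | riemannZeta ρ = 0 ∧ 0 < ρ.re ∧ ρ.re < 1}

/-- The displacement `δ` of `ρ = 1/2 + δ + iβ` from the critical line. -/
def zeroDelta (ρ : ℂ) : ℝ := ρ.re - 1 / 2

/-- The ordinate `β` of `ρ = 1/2 + δ + iβ`. -/
def zeroBeta (ρ : ℂ) : ℝ := ρ.im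

/-- `Ω₁`: the non-trivial zeros on the critical line in the upper half plane. -/
def Omega1 : Set ℂ :=
  {ρ : ℂ | ρ ∈ nontrivialZeros ∧ zeroDelta ρ = 0 ∧ 0 < zeroBeta ρ}

/-- `Ω₂`: the non-trivial zeros to the right of the critical line in the upper half plane;
each represents a quadruplet `ρ, 1 - ρ, conj ρ, 1 - conj ρ` of zeros off the line. -/
def Omega2 : Set ℂ :=
  {ρ : ℂ | ρ ∈ nontrivialZeros ∧ 0 < zeroDelta ρ ∧ 0 < zeroBeta ρ}

/-- The multiplicity of `ρ` as a zero of the Riemann zeta function. -/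
def zeroMult (ρ : ℂ) : ℕ := analyticOrderNatAt riemannZeta ρ

/-- `1 / ((1/2)² + β²)`, the contribution of a zero in `Ω₁`. -/
def lambdaTerm (ρ : ℂ) : ℝ := 1 / ((1 / 2) ^ 2 + zeroBeta ρ ^ 2)

/-- `(1/2 - 2δ² + 2β²) / (((1/2 + δ)² + β²) ((1/2 - δ)² + β²))`,
the contribution of a zero in `Ω₂`. -/
def muTerm (ρ : ℂ) : ℝ :=
  (1 / 2 - 2 * zeroDelta ρ ^ 2 + 2 * zeroBeta ρ ^ 2) /
    (((1 / 2 + zeroDelta ρ) ^ 2 + zeroBeta ρ ^ 2) *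
      ((1 / 2 - zeroDelta ρ) ^ 2 + zeroBeta ρ ^ 2))

/-- `λ`: the sum over `Ω₁`, every zero repeated according to its multiplicity. -/
def lambdaSum : ℝ := ∑' ρ : Omega1, (zeroMult ρ : ℝ) * lambdaTerm ρ

/-- `μ`: the sum over `Ω₂`, every zero repeated according to its multiplicity. -/
def muSum : ℝ := ∑' ρ : Omega2, (zeroMult ρ : ℝ) * muTerm ρ

end

open Filter Topology Metric

/-- An entire function splits off the zero at `a` with its full multiplicity. -/
lemma Differentiable.exists_eq_pow_mul {f : ℂ → ℂ} (hf : Differentiable ℂ f) {a : ℂ}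
    (ha : analyticOrderAt f a ≠ ⊤) :
    ∃ g : ℂ → ℂ, Differentiable ℂ g ∧ g a ≠ 0 ∧
      ∀ z, f z = (z - a) ^ analyticOrderNatAt f a * g z := by
  set n := analyticOrderNatAt f a
  obtain ⟨g₀, hg₀, hne, heq⟩ := ((hf.analyticAt a).analyticOrderAt_ne_top).1 ha
  have hval : ∀ z ≠ a, (z - a) ^ n ≠ 0 := fun z hz ↦ pow_ne_zero _ (sub_ne_zero.2 hz)
  refine ⟨Function.update (fun z ↦ f z / (z - a) ^ n) a (g₀ a), fun z ↦ ?_, by simpa, fun z ↦ ?_⟩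
  · rcases eq_or_ne z a with rfl | hz
    · refine hg₀.differentiableAt.congr_of_eventuallyEq ?_
      filter_upwards [heq] with y hy
      rcases eq_or_ne y z with rfl | hyz
      · simp
      · rw [Function.update_of_ne hyz, hy, smul_eq_mul, mul_div_cancel_left₀ _ (hval y hyz)]
    · have : DifferentiableAt ℂ (fun z ↦ f z / (z - a) ^ n) z :=
        (hf z).div (by fun_prop) (hval z hz)
      refine this.congr_of_eventuallyEq ?_
      filter_upwards [isOpen_ne.mem_nhds hz] with y hy
      rw [Function.update_of_ne hy]
  · rcases eq_or_ne z a with rfl | hz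
    · simpa using heq.self_of_nhds
    · rw [Function.update_of_ne hz, mul_div_cancel₀ _ (hval z hz)]

/-- An entire function splits off finitely many zeros with their full multiplicities. -/
lemma Differentiable.exists_eq_prod_mul {f : ℂ → ℂ} (hf : Differentiable ℂ f)
    (hord : ∀ a, analyticOrderAt f a ≠ ⊤) (S : Finset ℂ) :
    ∃ g : ℂ → ℂ, Differentiable ℂ g ∧ (∀ a ∈ S, g a ≠ 0) ∧
      ∀ z, f z = (∏ a ∈ S, (z - a) ^ analyticOrderNatAt f a) * g z := by
  classical
  induction S using Finset.induction_on with
  | empty => exact ⟨f, hf, by simp, by simp⟩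
  | insert a S haS ih =>
    obtain ⟨g, hg, hgS, hfg⟩ := ih
    set P : ℂ → ℂ := fun z ↦ ∏ b ∈ S, (z - b) ^ analyticOrderNatAt f b
    have hP : Differentiable ℂ P := by fun_prop
    have hPa : P a ≠ 0 := Finset.prod_ne_zero_iff.2 fun b hb ↦
      pow_ne_zero _ (sub_ne_zero.2 fun h ↦ haS (h ▸ hb))
    have horder : analyticOrderAt f a = analyticOrderAt g a := by
      have : f = P * g := funext hfg
      rw [this, analyticOrderAt_mul (hP.analyticAt a) (hg.analyticAt a),
        ((hP.analyticAt a).analyticOrderAt_eq_zero).2 hPa, zero_add]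
    obtain ⟨k, hk, hka, hgk⟩ := hg.exists_eq_pow_mul (horder ▸ hord a)
    refine ⟨k, hk, fun b hb ↦ ?_, fun z ↦ ?_⟩
    · rcases Finset.mem_insert.1 hb with rfl | hb
      · exact hka
      · have := hgS b hb
        rw [hgk b] at this
        exact right_ne_zero_of_mul this
    · rw [Finset.prod_insert haS, hfg z, hgk z, analyticOrderNatAt, analyticOrderNatAt, horder]
      ring

/-- A zero-free function on a disc has a holomorphic logarithm there. -/
lemma Complex.exists_log_on_ball {g : ℂ → ℂ} {R : ℝ} (hg : Differentiable ℂ g)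
    (hR : 0 < R) (hne : ∀ z ∈ ball (0 : ℂ) R, g z ≠ 0) :
    ∃ l : ℂ → ℂ, l 0 = 0 ∧ (∀ z ∈ ball (0 : ℂ) R, HasDerivAt l (logDeriv g z) z) ∧
      ∀ z ∈ ball (0 : ℂ) R, g z = g 0 * Complex.exp (l z) := by
  have hd : DifferentiableOn ℂ (logDeriv g) (ball 0 R) := fun z hz ↦
    ((hg.analyticAt z).deriv.differentiableAt.div (hg z) (hne z hz)).differentiableWithinAt
  obtain ⟨l, hl0, hl⟩ := hd.isExactOn_ball.with_val_at 0 0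
  refine ⟨l, hl0, hl, fun z hz ↦ ?_⟩
  have hder : ∀ y ∈ ball (0 : ℂ) R, HasDerivAt (fun y ↦ g y * Complex.exp (-l y)) 0 y := by
    intro y hy
    have h := (hg y).hasDerivAt.mul (hl y hy).neg.cexp
    refine h.congr_deriv ?_
    have := hne y hy
    rw [logDeriv_apply]
    field_simp
    ring
  have hconst := (convex_ball (0 : ℂ) R).is_const_of_fderivWithin_eq_zero (𝕜 := ℂ)
    (f := fun y ↦ g y * Complex.exp (-l y))
    (fun y hy ↦ (hder y hy).differentiableAt.differentiableWithinAt)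
    (fun y hy ↦ by
      rw [fderivWithin_of_isOpen isOpen_ball hy]
      ext
      simpa using (hder y hy).deriv) hz (mem_ball_self hR)
  simp only [hl0, neg_zero, Complex.exp_zero, mul_one] at hconst
  rw [← hconst, mul_assoc, ← Complex.exp_add, neg_add_cancel, Complex.exp_zero, mul_one]

/-- The logarithmic derivative of a zero-free function of controlled growth varies slowly. -/
lemma Complex.norm_logDeriv_sub_le {g : ℂ → ℂ} {R A : ℝ} (hg : Differentiable ℂ g)
    (hR : 0 < R) (hA : 0 < A) (hne : ∀ z ∈ ball (0 : ℂ) R, g z ≠ 0)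
    (hbound : ∀ z ∈ ball (0 : ℂ) R, ‖g z‖ ≤ Real.exp A * ‖g 0‖) {w : ℂ} (hw : ‖w‖ ≤ R / 8) :
    ‖logDeriv g w - logDeriv g 0‖ ≤ 64 * A / R ^ 2 * ‖w‖ := by
  obtain ⟨l, hl0, hl, hexp⟩ := Complex.exists_log_on_ball hg hR hne
  have hld : DifferentiableOn ℂ l (ball 0 R) := fun z hz ↦
    (hl z hz).differentiableAt.differentiableWithinAt
  have hre : Set.MapsTo l (ball 0 R) {z | z.re ≤ A} := by
    intro z hz
    have h := hbound z hz
    rw [hexp z hz, norm_mul, Complex.norm_exp, mul_comm] at h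
    exact Real.exp_le_exp.1
      (le_of_mul_le_mul_right h (norm_pos_iff.2 (hne 0 (mem_ball_self hR))))
  have hl2 : ∀ z, ‖z‖ ≤ R / 2 → ‖l z‖ ≤ 2 * A := by
    intro z hz
    have hzR : ‖z‖ < R := by linarith
    refine (borelCaratheodory_zero hA hld hre hR (by simpa using hzR) hl0).trans ?_
    rw [div_le_iff₀ (by linarith)]
    nlinarith
  have hsub : ∀ {z c : ℂ} {r s : ℝ}, ‖c‖ ≤ r → z ∈ closedBall c s → ‖z‖ ≤ r + s := by
    intro z c r s hc hz
    have := norm_le_norm_add_norm_sub' z c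
    rw [mem_closedBall, dist_eq_norm] at hz
    linarith
  have hd1 : ∀ z, ‖z‖ ≤ R / 4 → ‖deriv l z‖ ≤ 8 * A / R := by
    intro z hz
    have h := norm_deriv_le_of_forall_mem_sphere_norm_le (f := l) (c := z) (R := R / 4)
      (C := 2 * A) (by positivity)
      ((hld.mono fun y hy ↦ by
        have := hsub hz hy
        rw [mem_ball_zero_iff]; linarith).diffContOnCl_ball subset_rfl)
      (fun y hy ↦ hl2 y (by linarith [hsub hz (sphere_subset_closedBall hy)]))
    refine h.trans_eq ?_
    field_simp
    norm_num
  have hld' : DifferentiableOn ℂ (deriv l) (ball 0 R) := hld.deriv isOpen_ball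
  have hd2 : ∀ z, ‖z‖ ≤ R / 8 → ‖deriv (deriv l) z‖ ≤ 64 * A / R ^ 2 := by
    intro z hz
    have h := norm_deriv_le_of_forall_mem_sphere_norm_le (f := deriv l) (c := z) (R := R / 8)
      (C := 8 * A / R) (by positivity)
      ((hld'.mono fun y hy ↦ by
        have := hsub hz hy
        rw [mem_ball_zero_iff]; linarith).diffContOnCl_ball subset_rfl)
      (fun y hy ↦ hd1 y (by linarith [hsub hz (sphere_subset_closedBall hy)]))
    refine h.trans_eq ?_
    field_simp
    norm_num
  have hmem : ∀ z, ‖z‖ ≤ R / 8 → z ∈ ball (0 : ℂ) R := fun z hz ↦ by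
    rw [mem_ball_zero_iff]; linarith
  have h := (convex_closedBall (0 : ℂ) (R / 8)).norm_image_sub_le_of_norm_deriv_le
    (f := deriv l) (C := 64 * A / R ^ 2)
    (fun z hz ↦ (hld'.differentiableAt
      (isOpen_ball.mem_nhds (hmem z (by simpa using hz)))))
    (fun z hz ↦ hd2 z (by simpa using hz))
    (x := 0) (y := w) (by simpa using by positivity) (by simpa using hw)
  rwa [(hl w (hmem w hw)).deriv, (hl 0 (mem_ball_self hR)).deriv, sub_zero] at h

/-- The sum of `ord / (w - a)` over a finite set is the logarithmic derivative of the product. -/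
lemma logDeriv_eq_sum_add_of_eq_prod_mul {f g : ℂ → ℂ} (hg : Differentiable ℂ g) (S : Finset ℂ)
    (m : ℂ → ℕ) (hfg : ∀ z, f z = (∏ a ∈ S, (z - a) ^ m a) * g z) {w : ℂ} (hw : f w ≠ 0)
    (hwS : w ∉ S) :
    logDeriv f w = ∑ a ∈ S, (m a : ℂ) / (w - a) + logDeriv g w := by
  have hne : ∀ a ∈ S, w - a ≠ 0 := fun a ha h ↦ hwS (by rwa [sub_eq_zero.1 h])
  have hgw : g w ≠ 0 := fun h ↦ hw (by rw [hfg, h, mul_zero])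
  rw [show f = fun z ↦ (∏ a ∈ S, (z - a) ^ m a) * g z from funext hfg,
    logDeriv_mul (f := fun z ↦ ∏ a ∈ S, (z - a) ^ m a) w
      (Finset.prod_ne_zero_iff.2 fun a ha ↦ pow_ne_zero _ (hne a ha)) hgw
      (by fun_prop) (hg w)]
  congr 1
  rw [logDeriv_prod (f := fun a z ↦ (z - a) ^ m a) (fun a ha ↦ pow_ne_zero _ (hne a ha))
    (fun a _ ↦ by fun_prop)]
  refine Finset.sum_congr rfl fun a ha ↦ ?_
  rw [logDeriv_fun_pow (by fun_prop), logDeriv_apply]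
  simp [div_eq_mul_inv]

/-- Even functions have the same order of vanishing at `a` and `-a`. -/
lemma analyticOrderNatAt_neg_of_even {F : ℂ → ℂ} (heven : ∀ z, F (-z) = F z) (a : ℂ) :
    analyticOrderNatAt F (-a) = analyticOrderNatAt F a := by
  have h := analyticOrderAt_comp_of_deriv_ne_zero (f := F) (g := fun z : ℂ ↦ -z) (z₀ := a)
    (by fun_prop) (by simp)
  rw [show F ∘ (fun z : ℂ ↦ -z) = F from funext heven] at h
  rw [analyticOrderNatAt, analyticOrderNatAt, h]

lemma logDeriv_zero_of_even {F : ℂ → ℂ} (heven : ∀ z, F (-z) = F z) : logDeriv F 0 = 0 := by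
  have h := deriv_comp_neg F 0
  simp only [heven, neg_zero] at h
  rw [logDeriv_apply, self_eq_neg.1 h, zero_div]

/-- For an even entire function of growth `exp (o(|z|²))`, the logarithmic derivative is
the limit of the sums of `ord / (w - a)` over the zeros `a` in large discs. -/
theorem tendsto_sum_zeros_logDeriv {F : ℂ → ℂ} (hF : Differentiable ℂ F)
    (heven : ∀ z, F (-z) = F z) (h0 : F 0 ≠ 0)
    (hgrowth : ∀ ε > 0, ∀ᶠ r : ℝ in atTop, ∀ z, ‖z‖ = r → ‖F z‖ ≤ Real.exp (ε * r ^ 2))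
    (Z : ℝ → Finset ℂ) (hZ : ∀ R a, a ∈ Z R ↔ F a = 0 ∧ ‖a‖ ≤ R) {w : ℂ} (hw : F w ≠ 0) :
    Tendsto (fun R ↦ ∑ a ∈ Z R, (analyticOrderNatAt F a : ℂ) / (w - a)) atTop
      (𝓝 (logDeriv F w)) := by
  have hord : ∀ a, analyticOrderAt F a ≠ ⊤ := fun a h ↦ by
    rw [AnalyticOnNhd.analyticOrderAt_eq_top_iff_eq_zero a (fun z ↦ hF.analyticAt z)] at h
    exact h0 (congrFun h 0)
  obtain ⟨c, hc, hcF⟩ : ∃ c : ℝ, 0 < c ∧ -c ≤ Real.log ‖F 0‖ :=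
    ⟨|Real.log ‖F 0‖| + 1, by positivity, by linarith [neg_abs_le (Real.log ‖F 0‖)]⟩
  have key : ∀ ε > 0, ∀ᶠ R : ℝ in atTop,
      ‖∑ a ∈ Z R, (analyticOrderNatAt F a : ℂ) / (w - a) - logDeriv F w‖ ≤
        64 * (ε * (2 * R) ^ 2 + c) / R ^ 2 * ‖w‖ := by
    intro ε hε
    filter_upwards [(tendsto_id.const_mul_atTop (two_pos (α := ℝ))).eventually (hgrowth ε hε),
      eventually_gt_atTop 0, eventually_ge_atTop (8 * ‖w‖)] with R hM hR hwR
    simp only [id] at hM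
    obtain ⟨g, hg, hgZ, hFg⟩ := hF.exists_eq_prod_mul hord (Z R)
    have hnotin : ∀ {v}, F v ≠ 0 → v ∉ Z R := fun hv h ↦ hv ((hZ R _).1 h).1
    have hgne : ∀ z ∈ ball (0 : ℂ) R, g z ≠ 0 := by
      intro z hz hgz
      exact hgZ z ((hZ R z).2 ⟨by rw [hFg, hgz, mul_zero], (mem_ball_zero_iff.1 hz).le⟩) hgz
    have hlog0 : logDeriv g 0 = 0 := by
      have h := logDeriv_eq_sum_add_of_eq_prod_mul hg _ _ hFg h0 (hnotin h0)
      rw [logDeriv_zero_of_even heven] at h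
      have hneg : ∑ a ∈ Z R, (analyticOrderNatAt F a : ℂ) / (0 - a) =
          ∑ a ∈ Z R, -((analyticOrderNatAt F a : ℂ) / (0 - a)) :=
        Finset.sum_nbij' (fun a ↦ -a) (fun a ↦ -a)
          (fun a ha ↦ by simpa [hZ, heven] using (hZ R a).1 ha)
          (fun a ha ↦ by simpa [hZ, heven] using (hZ R a).1 ha)
          (fun a _ ↦ neg_neg a) (fun a _ ↦ neg_neg a)
          (fun a _ ↦ by
            rw [analyticOrderNatAt_neg_of_even heven, zero_sub, zero_sub, neg_neg, div_neg])
      rw [Finset.sum_neg_distrib, self_eq_neg] at hneg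
      rwa [hneg, zero_add, eq_comm] at h
    have hbound : ∀ z ∈ ball (0 : ℂ) R,
        ‖g z‖ ≤ Real.exp (ε * (2 * R) ^ 2 + c) * ‖g 0‖ := by
      intro z hz
      have hsphere : ∀ y ∈ frontier (ball (0 : ℂ) (2 * R)),
          ‖g y‖ ≤ Real.exp (ε * (2 * R) ^ 2 + c) * ‖g 0‖ := by
        intro y hy
        rw [frontier_ball _ (by positivity), mem_sphere_zero_iff_norm] at hy
        have hprod : ∏ a ∈ Z R, ‖(0 - a) ^ analyticOrderNatAt F a‖ ≤
            ∏ a ∈ Z R, ‖(y - a) ^ analyticOrderNatAt F a‖ := by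
          refine Finset.prod_le_prod (fun _ _ ↦ norm_nonneg _) fun a ha ↦ ?_
          rw [norm_pow, norm_pow, zero_sub, norm_neg]
          have h1 := ((hZ R a).1 ha).2
          have h2 := norm_sub_norm_le y a
          gcongr
          linarith
        have hFy := hM y hy
        have hF0 : Real.exp (-c) ≤ ‖F 0‖ := by
          rwa [← Real.le_log_iff_exp_le (norm_pos_iff.2 h0)]
        rw [hFg, norm_mul, norm_prod] at hFy hF0
        set p := ∏ a ∈ Z R, ‖(0 - a) ^ analyticOrderNatAt F a‖
        have hp : 0 < p := Finset.prod_pos fun a ha ↦ norm_pos_iff.2 <| pow_ne_zero _ <|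
          sub_ne_zero.2 fun h ↦ hnotin h0 (h ▸ ha)
        have h1 : p * ‖g y‖ ≤ Real.exp (ε * (2 * R) ^ 2) :=
          (mul_le_mul_of_nonneg_right hprod (norm_nonneg _)).trans hFy
        have h2 : 1 ≤ Real.exp c * (p * ‖g 0‖) := by
          have := mul_le_mul_of_nonneg_left hF0 (Real.exp_pos c).le
          rwa [← Real.exp_add, add_neg_cancel, Real.exp_zero] at this
        refine le_of_mul_le_mul_left ?_ hp
        calc p * ‖g y‖ ≤ Real.exp (ε * (2 * R) ^ 2) * 1 := by rwa [mul_one]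
          _ ≤ Real.exp (ε * (2 * R) ^ 2) * (Real.exp c * (p * ‖g 0‖)) := by gcongr
          _ = p * (Real.exp (ε * (2 * R) ^ 2 + c) * ‖g 0‖) := by rw [Real.exp_add]; ring
      exact Complex.norm_le_of_forall_mem_frontier_norm_le isBounded_ball
        hg.diffContOnCl hsphere
        (subset_closure (ball_subset_ball (by linarith) hz))
    have h := Complex.norm_logDeriv_sub_le hg hR (by positivity) hgne hbound
      (w := w) (by linarith)
    rw [hlog0, sub_zero] at h
    rwa [logDeriv_eq_sum_add_of_eq_prod_mul hg _ _ hFg hw (hnotin hw), sub_add_cancel_left,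
      norm_neg]
  rw [tendsto_iff_norm_sub_tendsto_zero]
  refine Metric.tendsto_nhds.2 fun δ hδ ↦ ?_
  have hlim : Tendsto (fun R : ℝ ↦ 64 * c * ‖w‖ / R ^ 2) atTop (𝓝 0) :=
    tendsto_const_nhds.div_atTop (tendsto_pow_atTop two_ne_zero)
  filter_upwards [key (δ / (512 * (‖w‖ + 1))) (by positivity),
    hlim.eventually (gt_mem_nhds (half_pos hδ)), eventually_gt_atTop 0] with R h1 h2 hR
  rw [Real.dist_0_eq_abs, abs_norm]
  refine h1.trans_lt ?_
  have h3 : 64 * (δ / (512 * (‖w‖ + 1)) * (2 * R) ^ 2 + c) / R ^ 2 * ‖w‖ =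
      δ / 2 * (‖w‖ / (‖w‖ + 1)) + 64 * c * ‖w‖ / R ^ 2 := by
    field_simp
    ring
  have h4 : ‖w‖ / (‖w‖ + 1) ≤ 1 := (div_le_one (by positivity)).2 (by linarith)
  rw [h3]
  nlinarith

section CompletedZeta
open HurwitzZeta MeasureTheory Set

lemma one_le_evenKernel_zero {t : ℝ} (ht : 0 < t) : 1 ≤ evenKernel 0 t := by
  have h := hasSum_int_evenKernel 0 ht
  simpa using le_hasSum h 0 fun n _ ↦ (Real.exp_pos _).le

/-- The modified theta kernel, whose Mellin transform is the entire completed zeta function,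
takes nonnegative real values. -/
lemma f_modif_eq_norm {t : ℝ} (ht : 0 < t) :
    (hurwitzEvenFEPair 0).f_modif t = (‖(hurwitzEvenFEPair 0).f_modif t‖ : ℂ) := by
  suffices h : ∃ r : ℝ, 0 ≤ r ∧ (hurwitzEvenFEPair 0).f_modif t = r by
    obtain ⟨r, hr, h⟩ := h
    rw [h, Complex.norm_real, Real.norm_of_nonneg hr]
  rcases lt_trichotomy t 1 with h | rfl | h
  · refine ⟨evenKernel 0 t - t ^ (-(1 / 2 : ℝ)), ?_, ?_⟩
    · rw [evenKernel_functional_equation, ← evenKernel_eq_cosKernel_of_zero,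
        Real.rpow_neg ht.le, one_div, sub_nonneg]
      exact le_mul_of_one_le_right (by positivity) (one_le_evenKernel_zero (by positivity))
    · simp [WeakFEPair.f_modif, hurwitzEvenFEPair, ht, h, h.le, not_lt]
  · exact ⟨0, le_rfl, by simp [WeakFEPair.f_modif]⟩
  · refine ⟨evenKernel 0 t - 1, by linarith [one_le_evenKernel_zero ht], ?_⟩
    simp [WeakFEPair.f_modif, hurwitzEvenFEPair, h, h.le]

/-- The Mellin transform of the theta kernel on the real axis. -/
noncomputable def thetaMellin (σ : ℝ) : ℝ :=
  (∫ t in Ioi (0 : ℝ), t ^ (σ / 2 - 1) * ‖(hurwitzEvenFEPair 0).f_modif t‖) / 2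

lemma norm_cpow_smul_f_modif (s : ℂ) {t : ℝ} (ht : 0 < t) :
    ‖(t : ℂ) ^ (s / 2 - 1) • (hurwitzEvenFEPair 0).f_modif t‖ =
      t ^ (s.re / 2 - 1) * ‖(hurwitzEvenFEPair 0).f_modif t‖ := by
  rw [norm_smul, Complex.norm_cpow_eq_rpow_re_of_pos ht]
  simp

lemma integrableOn_thetaMellin (σ : ℝ) :
    IntegrableOn (fun t : ℝ ↦ t ^ (σ / 2 - 1) * ‖(hurwitzEvenFEPair 0).f_modif t‖) (Ioi 0) := by
  have h : MellinConvergent (hurwitzEvenFEPair 0).f_modif ((σ : ℂ) / 2) :=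
    ((hurwitzEvenFEPair 0).isStrongFEPair_toStrongFEPair.hasMellin _).1
  refine IntegrableOn.congr_fun (Integrable.norm h) (fun t ht ↦ ?_) measurableSet_Ioi
  rw [norm_cpow_smul_f_modif _ ht, Complex.ofReal_re]

lemma completedRiemannZeta₀_ofReal (σ : ℝ) : completedRiemannZeta₀ σ = thetaMellin σ := by
  rw [completedRiemannZeta₀, completedHurwitzZetaEven₀, WeakFEPair.Λ₀, mellin, thetaMellin,
    Complex.ofReal_div, ← integral_complex_ofReal]
  congr 1
  refine setIntegral_congr_fun measurableSet_Ioi fun t ht ↦ ?_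
  rw [smul_eq_mul, f_modif_eq_norm ht, Complex.ofReal_mul, Complex.ofReal_cpow (le_of_lt ht)]
  simp

lemma norm_completedRiemannZeta₀_le (s : ℂ) : ‖completedRiemannZeta₀ s‖ ≤ thetaMellin s.re := by
  rw [completedRiemannZeta₀, completedHurwitzZetaEven₀, WeakFEPair.Λ₀, mellin, thetaMellin,
    norm_div, Complex.norm_two]
  gcongr
  refine (norm_integral_le_integral_norm _).trans_eq ?_
  exact setIntegral_congr_fun measurableSet_Ioi fun t ht ↦ norm_cpow_smul_f_modif s ht

lemma thetaMellin_nonneg (σ : ℝ) : 0 ≤ thetaMellin σ :=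
  div_nonneg (setIntegral_nonneg measurableSet_Ioi fun t (ht : 0 < t) ↦ by positivity) zero_le_two

lemma thetaMellin_le_add {a b σ : ℝ} (ha : a ≤ σ) (hb : σ ≤ b) :
    thetaMellin σ ≤ thetaMellin a + thetaMellin b := by
  rw [thetaMellin, thetaMellin, thetaMellin, ← add_div,
    ← integral_add (integrableOn_thetaMellin a) (integrableOn_thetaMellin b)]
  refine div_le_div_of_nonneg_right ?_ zero_le_two
  refine setIntegral_mono_on (integrableOn_thetaMellin σ)
    ((integrableOn_thetaMellin a).add (integrableOn_thetaMellin b)) measurableSet_Ioi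
    fun t (ht : 0 < t) ↦ ?_
  rw [← add_mul]
  gcongr
  have hpa : 0 < t ^ (a / 2 - 1) := by positivity
  have hpb : 0 < t ^ (b / 2 - 1) := by positivity
  rcases le_total t 1 with h | h
  · have := Real.rpow_le_rpow_of_exponent_ge ht h (by linarith : a / 2 - 1 ≤ σ / 2 - 1)
    linarith
  · have := Real.rpow_le_rpow_of_exponent_le h (by linarith : σ / 2 - 1 ≤ b / 2 - 1)
    linarith

lemma thetaMellin_one :
    thetaMellin 1 = 1 + Real.eulerMascheroniConstant / 2 - 1 / 2 * Real.log (4 * Real.pi) := by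
  have h := completedRiemannZeta₀_ofReal 1
  rw [Complex.ofReal_one, completedRiemannZeta₀_one] at h
  have hlog : Complex.log (4 * Real.pi) = (Real.log (4 * Real.pi) : ℝ) := by
    rw [Complex.ofReal_log (by positivity)]; push_cast; rfl
  rw [hlog] at h
  apply Complex.ofReal_injective
  rw [← h]
  push_cast
  ring

lemma thetaMellin_zero : thetaMellin 0 = thetaMellin 1 := by
  apply Complex.ofReal_injective
  rw [← completedRiemannZeta₀_ofReal, ← completedRiemannZeta₀_ofReal,
    ← completedRiemannZeta₀_one_sub]
  simp

lemma thetaMellin_one_lt_two : thetaMellin 1 < 2 := by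
  have h1 := Real.eulerMascheroniConstant_lt_two_thirds
  have h2 : 0 < Real.log (4 * Real.pi) := Real.log_pos (by linarith [Real.pi_gt_three])
  rw [thetaMellin_one]
  linarith

/-- Factorial growth of the completed zeta function at the even integers. -/
lemma exists_thetaMellin_le_factorial :
    ∃ C, 0 ≤ C ∧ ∀ n : ℕ, 1 ≤ n → thetaMellin (2 * n) ≤ 1 + C * n.factorial := by
  have hsum : Summable fun k : ℕ ↦ 1 / (k : ℝ) ^ 2 := Real.summable_one_div_nat_pow.2 one_lt_two
  refine ⟨∑' k : ℕ, 1 / (k : ℝ) ^ 2, tsum_nonneg fun _ ↦ by positivity, fun n hn ↦ ?_⟩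
  have hn' : (1 : ℝ) ≤ n := by exact_mod_cast hn
  set s : ℂ := ((2 * n : ℕ) : ℂ)
  have hs0 : s ≠ 0 := Nat.cast_ne_zero.2 (by omega)
  have hs1 : s ≠ 1 := by
    simp only [s]; exact_mod_cast (by omega : 2 * n ≠ 1)
  have hnorm : thetaMellin (2 * n) = ‖completedRiemannZeta₀ s‖ := by
    have := completedRiemannZeta₀_ofReal (2 * n)
    rw [show s = ((2 * n : ℝ) : ℂ) by simp [s], this, Complex.norm_real,
      Real.norm_of_nonneg (thetaMellin_nonneg _)]
  have hG : ‖Complex.Gammaℝ s‖ ≤ n.factorial := by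
    rw [Complex.Gammaℝ_def, norm_mul, Complex.norm_cpow_eq_rpow_re_of_pos Real.pi_pos,
      show s / 2 = ((n - 1 : ℕ) : ℂ) + 1 by simp [s, Nat.cast_sub hn],
      Complex.Gamma_nat_eq_factorial, Complex.norm_natCast]
    refine (mul_le_of_le_one_left (by positivity) ?_).trans
      (by exact_mod_cast Nat.factorial_le (Nat.sub_le n 1))
    refine Real.rpow_le_one_of_one_le_of_nonpos (by linarith [Real.pi_gt_three]) ?_
    have : (-s / 2).re = -(n : ℝ) := by
      rw [show -s / 2 = -((n : ℝ) : ℂ) by simp [s]; ring, Complex.neg_re, Complex.ofReal_re]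
    rw [this]
    linarith
  have hz : ‖riemannZeta s‖ ≤ ∑' k : ℕ, 1 / (k : ℝ) ^ 2 := by
    rw [zeta_nat_eq_tsum_of_gt_one (by omega)]
    refine tsum_of_norm_bounded hsum.hasSum fun k ↦ ?_
    rcases Nat.eq_zero_or_pos k with rfl | hk
    · simp [show 2 * n ≠ 0 by omega]
    · rw [norm_div, norm_one, norm_pow, Complex.norm_natCast]
      have : (1 : ℝ) ≤ k := by exact_mod_cast hk
      gcongr
      omega
  have heq : completedRiemannZeta₀ s =
      riemannZeta s * Complex.Gammaℝ s + (1 / s + 1 / (1 - s)) := by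
    have hG0 : Complex.Gammaℝ s ≠ 0 := Complex.Gammaℝ_ne_zero_of_re_pos (by simp [s]; omega)
    rw [riemannZeta_def_of_ne_zero hs0, div_mul_cancel₀ _ hG0, completedRiemannZeta_eq]
    ring
  have hrat : ‖1 / s + 1 / (1 - s)‖ ≤ 1 := by
    have : 1 / s + 1 / (1 - s) = ((1 / (2 * n) - 1 / (2 * n - 1) : ℝ) : ℂ) := by
      have : (1 : ℂ) - s = -(s - 1) := by ring
      rw [this, div_neg]
      simp [s]
      ring
    rw [this, Complex.norm_real, Real.norm_eq_abs, abs_le]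
    have h1 : 1 / (2 * n - 1 : ℝ) ≤ 1 := (div_le_one (by linarith)).2 (by linarith)
    have h2 : 0 ≤ 1 / (2 * n : ℝ) := by positivity
    have h3 : 1 / (2 * n : ℝ) ≤ 1 := (div_le_one (by linarith)).2 (by linarith)
    have h4 : 0 ≤ 1 / (2 * n - 1 : ℝ) := div_nonneg one_pos.le (by linarith)
    constructor <;> linarith
  rw [hnorm, heq]
  refine (norm_add_le _ _).trans ?_
  rw [norm_mul, add_comm]
  gcongr

end CompletedZeta

/-- The Riemann xi function, normalised by `ξ 1 = 1`. -/
noncomputable def riemannXi (s : ℂ) : ℂ := 1 + s * (s - 1) * completedRiemannZeta₀ s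

lemma differentiable_riemannXi : Differentiable ℂ riemannXi := by
  have := differentiable_completedZeta₀
  unfold riemannXi
  fun_prop

lemma riemannXi_one_sub (s : ℂ) : riemannXi (1 - s) = riemannXi s := by
  rw [riemannXi, riemannXi, completedRiemannZeta₀_one_sub]
  ring

lemma riemannXi_one : riemannXi 1 = 1 := by simp [riemannXi]

lemma logDeriv_riemannXi_one : logDeriv riemannXi 1 = thetaMellin 1 := by
  have h : HasDerivAt riemannXi (completedRiemannZeta₀ 1) 1 := by
    have := ((((hasDerivAt_id (1 : ℂ)).mul ((hasDerivAt_id (1 : ℂ)).sub_const 1)).mul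
      (differentiable_completedZeta₀ 1).hasDerivAt).const_add 1)
    refine this.congr_deriv ?_
    simp
  rw [logDeriv_apply, h.deriv, riemannXi_one, div_one]
  exact_mod_cast completedRiemannZeta₀_ofReal 1

lemma riemannZeta_eq_riemannXi_mul {s : ℂ} (hs0 : s ≠ 0) (hs1 : s ≠ 1) :
    riemannZeta s = riemannXi s * ((Complex.Gammaℝ s)⁻¹ / (s * (s - 1))) := by
  have h1 : 1 - s ≠ 0 := sub_ne_zero.2 hs1.symm
  have h2 : s - 1 ≠ 0 := sub_ne_zero.2 hs1
  rw [riemannZeta_def_of_ne_zero hs0, completedRiemannZeta_eq, riemannXi, div_eq_mul_inv,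
    mul_div_assoc', mul_comm (1 + _), mul_div_assoc, mul_comm]
  congr 1
  rw [eq_div_iff (mul_ne_zero hs0 h2)]
  field_simp
  ring

lemma riemannXi_ne_zero_of_one_le_re {s : ℂ} (hs : 1 ≤ s.re) : riemannXi s ≠ 0 := by
  rcases eq_or_ne s 1 with rfl | hs1
  · simp [riemannXi_one]
  · intro h
    have hs0 : s ≠ 0 := by rintro rfl; norm_num at hs
    exact riemannZeta_ne_zero_of_one_le_re hs
      (by rw [riemannZeta_eq_riemannXi_mul hs0 hs1, h, zero_mul])

lemma riemannXi_eq_zero_iff {s : ℂ} : riemannXi s = 0 ↔ s ∈ nontrivialZeros := by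
  constructor
  · intro h
    have h1 : s.re < 1 := not_le.1 fun hs ↦ riemannXi_ne_zero_of_one_le_re hs h
    have h0 : 0 < s.re := not_le.1 fun hs ↦
      riemannXi_ne_zero_of_one_le_re (s := 1 - s) (by simpa using hs)
        (by rwa [riemannXi_one_sub])
    refine ⟨?_, h0, h1⟩
    rw [riemannZeta_eq_riemannXi_mul (by rintro rfl; simp at h0) (by rintro rfl; simp at h1),
      h, zero_mul]
  · rintro ⟨hz, h0, h1⟩
    have hs0 : s ≠ 0 := by rintro rfl; simp at h0
    have hs1 : s ≠ 1 := by rintro rfl; simp at h1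
    rw [riemannZeta_eq_riemannXi_mul hs0 hs1] at hz
    refine (mul_eq_zero.1 hz).resolve_right ?_
    exact div_ne_zero (inv_ne_zero (Complex.Gammaℝ_ne_zero_of_re_pos h0))
      (mul_ne_zero hs0 (sub_ne_zero.2 hs1))

lemma analyticOrderNatAt_riemannXi {s : ℂ} (hs : s ∈ nontrivialZeros) :
    analyticOrderNatAt riemannXi s = zeroMult s := by
  obtain ⟨-, h0, h1⟩ := hs
  have hs0 : s ≠ 0 := by rintro rfl; simp at h0
  have hs1 : s ≠ 1 := by rintro rfl; simp at h1
  have hopen : IsOpen ({0}ᶜ ∩ {1}ᶜ : Set ℂ) := isOpen_compl_singleton.inter isOpen_compl_singleton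
  have hu : AnalyticAt ℂ (fun s ↦ (Complex.Gammaℝ s)⁻¹ / (s * (s - 1))) s := by
    refine DifferentiableOn.analyticAt (s := {0}ᶜ ∩ {1}ᶜ) (fun z hz ↦ ?_)
      (hopen.mem_nhds ⟨hs0, hs1⟩)
    refine ((Complex.differentiable_Gammaℝ_inv z).div (by fun_prop) ?_).differentiableWithinAt
    exact mul_ne_zero hz.1 (sub_ne_zero.2 hz.2)
  have heq : riemannZeta =ᶠ[𝓝 s]
      riemannXi * fun s ↦ (Complex.Gammaℝ s)⁻¹ / (s * (s - 1)) := by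
    filter_upwards [hopen.mem_nhds ⟨hs0, hs1⟩] with z hz
    exact riemannZeta_eq_riemannXi_mul hz.1 hz.2
  have hu0 : analyticOrderAt (fun s ↦ (Complex.Gammaℝ s)⁻¹ / (s * (s - 1))) s = 0 :=
    hu.analyticOrderAt_eq_zero.2 <| div_ne_zero
      (inv_ne_zero (Complex.Gammaℝ_ne_zero_of_re_pos h0)) (mul_ne_zero hs0 (sub_ne_zero.2 hs1))
  rw [zeroMult, analyticOrderNatAt, analyticOrderNatAt, analyticOrderAt_congr heq,
    analyticOrderAt_mul (differentiable_riemannXi.analyticAt s) hu, hu0, add_zero]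

/-- The Riemann zeta function has no real zeros in the critical strip. -/
lemma im_ne_zero_of_mem_nontrivialZeros {s : ℂ} (hs : s ∈ nontrivialZeros) : s.im ≠ 0 := by
  intro him
  have hxi := riemannXi_eq_zero_iff.2 hs
  obtain ⟨-, h0, h1⟩ := hs
  have hsre : s = (s.re : ℂ) := Complex.ext rfl (by simpa using him)
  rw [hsre, riemannXi, completedRiemannZeta₀_ofReal] at hxi
  have hreal : 1 + s.re * (s.re - 1) * thetaMellin s.re = 0 := by exact_mod_cast hxi
  have hle := thetaMellin_le_add h0.le h1.le
  rw [thetaMellin_zero] at hle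
  have h2 := thetaMellin_one_lt_two
  have h3 := thetaMellin_nonneg s.re
  nlinarith [sq_nonneg (s.re - 1 / 2), mul_nonneg h3 (sq_nonneg (s.re - 1 / 2))]

/-- The growth of `ξ` is that of a function of order one, and in particular `exp (o(|z|²))`. -/
lemma norm_riemannXi_le {ε : ℝ} (hε : 0 < ε) : ∀ᶠ r : ℝ in atTop, ∀ z : ℂ, ‖z‖ = r →
    ‖riemannXi (1 / 2 + z)‖ ≤ Real.exp (ε * r ^ 2) := by
  obtain ⟨C, hC, hfac⟩ := exists_thetaMellin_le_factorial
  set B : ℝ := 1 + 4 * (thetaMellin 0 + 1 + C)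
  have hB : 1 ≤ B := by have := thetaMellin_nonneg 0; simp only [B]; linarith
  have hlog : ∀ᶠ r : ℝ in atTop, Real.log (2 * r) ≤ ε / 16 * (2 * r) := by
    have h := (Real.isLittleO_log_id_atTop.bound (by positivity : 0 < ε / 16))
    have h2 := (tendsto_id.const_mul_atTop (two_pos (α := ℝ))).eventually h
    filter_upwards [h2, eventually_gt_atTop 0] with r hr hr0
    simp only [id, Real.norm_eq_abs] at hr
    rw [abs_of_pos (by positivity : 0 < 2 * r)] at hr
    exact (le_abs_self _).trans hr
  have hsq : Tendsto (fun r : ℝ ↦ ε / 4 * r ^ 2) atTop atTop :=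
    (tendsto_pow_atTop two_ne_zero).const_mul_atTop (by positivity)
  filter_upwards [hlog, hsq.eventually_ge_atTop (Real.log B), eventually_ge_atTop 1,
    eventually_ge_atTop (4 / ε)] with r hr1 hr2 hr3 hr4 z hz
  have hr0 : 0 < r := by linarith
  have hr5 : r ≤ ε / 4 * r ^ 2 := by
    have : 4 ≤ ε * r := by rw [div_le_iff₀ hε] at hr4; linarith
    nlinarith
  have hmain : ∀ s : ℂ, 0 ≤ s.re → s.re ≤ 2 * r →
      ‖completedRiemannZeta₀ s‖ ≤ (thetaMellin 0 + 1 + C) * Real.exp (2 * r * Real.log (2 * r)) := by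
    intro s hs1 hs2
    have hceil : (⌈r⌉₊ : ℝ) ≤ 2 * r := by linarith [Nat.ceil_lt_add_one hr0.le]
    have hn : 1 ≤ ⌈r⌉₊ := Nat.one_le_ceil_iff.2 hr0
    have hf : (Nat.factorial ⌈r⌉₊ : ℝ) ≤ Real.exp (2 * r * Real.log (2 * r)) := by
      calc (Nat.factorial ⌈r⌉₊ : ℝ) ≤ (⌈r⌉₊ : ℝ) ^ ⌈r⌉₊ := by
            exact_mod_cast Nat.factorial_le_pow _
        _ ≤ (2 * r) ^ ⌈r⌉₊ := by gcongr
        _ = Real.exp (⌈r⌉₊ * Real.log (2 * r)) := by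
            rw [Real.exp_nat_mul, Real.exp_log (by positivity)]
        _ ≤ _ := by
            have : 0 ≤ Real.log (2 * r) := Real.log_nonneg (by linarith)
            gcongr
    have he : 1 ≤ Real.exp (2 * r * Real.log (2 * r)) :=
      Real.one_le_exp (mul_nonneg (by positivity) (Real.log_nonneg (by linarith)))
    have h1 := norm_completedRiemannZeta₀_le s
    have h2 := thetaMellin_le_add hs1 (hs2.trans
      (mul_le_mul_of_nonneg_left (Nat.le_ceil r) zero_le_two))
    have h3 := hfac _ hn
    have h4 := mul_le_mul_of_nonneg_left hf hC
    have h5 := mul_le_mul_of_nonneg_left he (thetaMellin_nonneg 0)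
    linarith
  have hzeta : ‖completedRiemannZeta₀ (1 / 2 + z)‖ ≤
      (thetaMellin 0 + 1 + C) * Real.exp (2 * r * Real.log (2 * r)) := by
    have hre := Complex.abs_re_le_norm z
    rw [hz, abs_le] at hre
    have hhalf : ((1 : ℂ) / 2).re = 1 / 2 := by norm_num
    rcases le_total 0 z.re with h | h
    · exact hmain _ (by rw [Complex.add_re, hhalf]; linarith)
        (by rw [Complex.add_re, hhalf]; linarith)
    · rw [← completedRiemannZeta₀_one_sub]
      exact hmain _ (by rw [Complex.sub_re, Complex.add_re, hhalf, Complex.one_re]; linarith)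
        (by rw [Complex.sub_re, Complex.add_re, hhalf, Complex.one_re]; linarith)
  have hpoly : ‖(1 / 2 + z) * (1 / 2 + z - 1)‖ ≤ 4 * Real.exp r := by
    have h1 : ‖1 / 2 + z‖ ≤ 1 + r := (norm_add_le _ _).trans (by rw [hz]; norm_num)
    have h2 : ‖1 / 2 + z - 1‖ ≤ 1 + r := by
      rw [show 1 / 2 + z - 1 = z - 1 / 2 by ring]
      refine (norm_sub_le _ _).trans ?_
      rw [hz]; norm_num; linarith
    have h3 : 1 + r ≤ 2 * Real.exp (r / 2) := by linarith [Real.add_one_le_exp (r / 2)]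
    rw [norm_mul]
    calc _ ≤ (2 * Real.exp (r / 2)) * (2 * Real.exp (r / 2)) :=
          mul_le_mul (h1.trans h3) (h2.trans h3) (norm_nonneg _) (by positivity)
      _ = 4 * (Real.exp (r / 2) * Real.exp (r / 2)) := by ring
      _ = 4 * Real.exp r := by rw [← Real.exp_add, add_halves]
  have hone : 1 ≤ Real.exp r * Real.exp (2 * r * Real.log (2 * r)) := by
    rw [← Real.exp_add]
    exact Real.one_le_exp (add_nonneg hr0.le
      (mul_nonneg (by positivity) (Real.log_nonneg (by linarith))))
  calc ‖riemannXi (1 / 2 + z)‖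
      ≤ 1 + ‖(1 / 2 + z) * (1 / 2 + z - 1)‖ * ‖completedRiemannZeta₀ (1 / 2 + z)‖ := by
        rw [riemannXi, ← norm_mul]
        exact (norm_add_le _ _).trans (by rw [norm_one])
    _ ≤ 1 + 4 * Real.exp r *
          ((thetaMellin 0 + 1 + C) * Real.exp (2 * r * Real.log (2 * r))) := by gcongr
    _ ≤ B * (Real.exp r * Real.exp (2 * r * Real.log (2 * r))) := by
        simp only [B]; linarith
    _ = Real.exp (Real.log B + (r + 2 * r * Real.log (2 * r))) := by
        rw [Real.exp_add, Real.exp_add, Real.exp_log (by linarith)]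
    _ ≤ Real.exp (ε * r ^ 2) := by
        gcongr
        nlinarith

open scoped ComplexConjugate

lemma AnalyticAt.conj_conj {f : ℂ → ℂ} {a : ℂ} (hf : AnalyticAt ℂ f a) :
    AnalyticAt ℂ (fun z ↦ conj (f (conj z))) (conj a) := by
  rw [Complex.analyticAt_iff_eventually_differentiableAt] at hf ⊢
  have ht : Tendsto (fun z : ℂ ↦ conj z) (𝓝 (conj a)) (𝓝 a) := by
    simpa using (Complex.continuous_conj.tendsto (conj a))
  filter_upwards [ht.eventually hf] with z hz
  exact differentiableAt_conj_conj_iff.2 hz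

/-- A function commuting with complex conjugation has equal orders at conjugate points. -/
lemma analyticOrderAt_conj {f : ℂ → ℂ} (hconj : ∀ z, f (conj z) = conj (f z)) {a : ℂ}
    (hf : AnalyticAt ℂ f a) : analyticOrderAt f (conj a) = analyticOrderAt f a := by
  have hf' : AnalyticAt ℂ f (conj a) := by simpa [hconj] using hf.conj_conj
  have ht : Tendsto (fun z : ℂ ↦ conj z) (𝓝 (conj a)) (𝓝 a) := by
    simpa using (Complex.continuous_conj.tendsto (conj a))
  rcases h : analyticOrderAt f a with _ | n
  · refine analyticOrderAt_eq_top.2 ?_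
    filter_upwards [ht.eventually (analyticOrderAt_eq_top.1 h)] with z hz
    simpa [hconj] using hz
  · obtain ⟨g, hg, hga, hfg⟩ := (hf.analyticOrderAt_eq_natCast (n := n)).1 h
    refine (hf'.analyticOrderAt_eq_natCast (n := n)).2
      ⟨fun z ↦ conj (g (conj z)), hg.conj_conj, by simpa using hga, ?_⟩
    filter_upwards [ht.eventually hfg] with z hz
    rw [hconj] at hz
    simpa using congrArg conj hz

lemma conj_mem_nontrivialZeros {ρ : ℂ} (hρ : ρ ∈ nontrivialZeros) :
    conj ρ ∈ nontrivialZeros := by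
  obtain ⟨hz, h0, h1⟩ := hρ
  exact ⟨by rw [riemannZeta_conj, hz, map_zero], by simpa using h0, by simpa using h1⟩

lemma one_sub_mem_nontrivialZeros {ρ : ℂ} (hρ : ρ ∈ nontrivialZeros) :
    1 - ρ ∈ nontrivialZeros := by
  rw [← riemannXi_eq_zero_iff, riemannXi_one_sub]
  exact riemannXi_eq_zero_iff.2 hρ

lemma zeroMult_conj {ρ : ℂ} (hρ : ρ ∈ nontrivialZeros) : zeroMult (conj ρ) = zeroMult ρ := by
  rw [zeroMult, zeroMult, analyticOrderNatAt, analyticOrderNatAt,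
    analyticOrderAt_conj riemannZeta_conj (analyticOn_riemannZeta ρ ?_)]
  rintro rfl
  exact absurd hρ.2.2 (by simp)

/-- The xi function recentred at the symmetry point, where it becomes even. -/
noncomputable def centredXi (z : ℂ) : ℂ := riemannXi (1 / 2 + z)

lemma differentiable_centredXi : Differentiable ℂ centredXi := by
  have := differentiable_riemannXi
  unfold centredXi
  fun_prop

lemma centredXi_neg (z : ℂ) : centredXi (-z) = centredXi z := by
  rw [centredXi, centredXi, ← riemannXi_one_sub]
  congr 1
  ring

lemma centredXi_eq_zero_iff {z : ℂ} : centredXi z = 0 ↔ 1 / 2 + z ∈ nontrivialZeros :=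
  riemannXi_eq_zero_iff

lemma centredXi_zero_ne_zero : centredXi 0 ≠ 0 := fun h ↦
  im_ne_zero_of_mem_nontrivialZeros (centredXi_eq_zero_iff.1 h) (by simp)

lemma analyticOrderNatAt_centredXi {z : ℂ} (hz : 1 / 2 + z ∈ nontrivialZeros) :
    analyticOrderNatAt centredXi z = zeroMult (1 / 2 + z) := by
  rw [← analyticOrderNatAt_riemannXi hz, analyticOrderNatAt, analyticOrderNatAt,
    ← analyticOrderAt_comp_of_deriv_ne_zero (f := riemannXi) (g := fun z : ℂ ↦ 1 / 2 + z)
      (by fun_prop) (by simp)]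
  rfl

lemma zeroMult_one_sub {ρ : ℂ} (hρ : ρ ∈ nontrivialZeros) : zeroMult (1 - ρ) = zeroMult ρ := by
  have h1 : (1 / 2 : ℂ) + (ρ - 1 / 2) = ρ := by ring
  have h2 : (1 / 2 : ℂ) + -(ρ - 1 / 2) = 1 - ρ := by ring
  have h := analyticOrderNatAt_neg_of_even centredXi_neg (ρ - 1 / 2)
  rwa [analyticOrderNatAt_centredXi (by rw [h2]; exact one_sub_mem_nontrivialZeros hρ),
    analyticOrderNatAt_centredXi (by rwa [h1]), h1, h2] at h

lemma finite_nontrivialZeros_inter_closedBall (R : ℝ) :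
    (nontrivialZeros ∩ closedBall (1 / 2) R).Finite :=
  ((isCompact_closedBall (1 / 2 : ℂ) R).inter_riemannZetaZeros_finite).subset
    fun _ h ↦ ⟨h.2, h.1.1⟩

/-- A nonnegative function is summed by any exhaustion of its support along which the partial
sums converge. -/
lemma hasSum_of_nonneg_of_tendsto {ι : Type*} {u : ι → ℝ} (hu : ∀ a, 0 ≤ u a) {L : ℝ}
    {Z : ℝ → Finset ι} (hZ : ∀ a, u a ≠ 0 → ∀ᶠ R in atTop, a ∈ Z R)
    (hlim : Tendsto (fun R ↦ ∑ a ∈ Z R, u a) atTop (𝓝 L)) : HasSum u L := by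
  classical
  have hle : ∀ S : Finset ι, ∑ a ∈ S, u a ≤ L := by
    intro S
    refine ge_of_tendsto hlim ?_
    have : ∀ᶠ R in atTop, ∀ a ∈ S.filter (u · ≠ 0), a ∈ Z R :=
      (Finset.eventually_all _).2 fun a ha ↦ hZ a (Finset.mem_filter.1 ha).2
    filter_upwards [this] with R hR
    rw [← Finset.sum_filter_ne_zero S]
    exact Finset.sum_le_sum_of_subset_of_nonneg hR fun a _ _ ↦ hu a
  have hs : Summable u := summable_of_sum_le hu hle
  refine hs.hasSum_iff.2 (le_antisymm (hs.tsum_le_of_sum_le hle) ?_)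
  exact le_of_tendsto' hlim fun R ↦ hs.sum_le_tsum _ fun a _ ↦ hu a

/-- The real part of `1 / (1 - ρ)`. -/
noncomputable def zeroTerm (ρ : ℂ) : ℝ := (1 - ρ.re) / ((1 - ρ.re) ^ 2 + ρ.im ^ 2)

lemma re_one_div_one_sub (ρ : ℂ) : (1 / (1 - ρ)).re = zeroTerm ρ := by
  rw [one_div, Complex.inv_re, Complex.normSq_apply, zeroTerm]
  simp
  ring

/-- The sum of `Re (1 / (1 - ρ))` over the nontrivial zeros is `ξ' / ξ` at `1`. -/
lemma hasSum_zeroTerm :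
    HasSum (nontrivialZeros.indicator fun ρ ↦ (zeroMult ρ : ℝ) * zeroTerm ρ)
      (thetaMellin 1) := by
  classical
  set S : ℝ → Finset ℂ := fun R ↦ (finite_nontrivialZeros_inter_closedBall R).toFinset
  have hS : ∀ R ρ, ρ ∈ S R ↔ ρ ∈ nontrivialZeros ∧ ‖ρ - 1 / 2‖ ≤ R := by
    simp [S, dist_eq_norm]
  refine hasSum_of_nonneg_of_tendsto (Z := S) (fun ρ ↦ ?_) (fun ρ hρ ↦ ?_) ?_
  · refine Set.indicator_nonneg (fun ρ hρ ↦ ?_) ρ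
    have : 0 < 1 - ρ.re := by linarith [hρ.2.2]
    rw [zeroTerm]
    positivity
  · filter_upwards [eventually_ge_atTop ‖ρ - 1 / 2‖] with R hR
    exact (hS R ρ).2 ⟨Set.mem_of_indicator_ne_zero hρ, hR⟩
  · have hmap : ∀ R a, a ∈ (S R).map (addRightEmbedding (-(1 / 2) : ℂ)) ↔
        centredXi a = 0 ∧ ‖a‖ ≤ R := by
      intro R a
      rw [centredXi_eq_zero_iff, Finset.mem_map]
      constructor
      · rintro ⟨ρ, hρ, rfl⟩
        simpa [sub_eq_add_neg] using (hS R ρ).1 hρ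
      · rintro ⟨h1, h2⟩
        exact ⟨1 / 2 + a, (hS _ _).2 ⟨h1, by simpa using h2⟩, by simp⟩
    have hhalf : (1 / 2 + 1 / 2 : ℂ) = 1 := by norm_num
    have hw : centredXi (1 / 2) ≠ 0 := by
      rw [centredXi, hhalf, riemannXi_one]
      exact one_ne_zero
    have h := tendsto_sum_zeros_logDeriv differentiable_centredXi centredXi_neg
      centredXi_zero_ne_zero (fun ε hε ↦ norm_riemannXi_le hε) _ hmap hw
    have hlog : logDeriv centredXi (1 / 2) = thetaMellin 1 := by
      rw [← logDeriv_riemannXi_one, logDeriv_apply, logDeriv_apply]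
      have hd : deriv centredXi (1 / 2) = deriv riemannXi (1 / 2 + 1 / 2) :=
        deriv_comp_const_add riemannXi (1 / 2) (1 / 2)
      rw [hd, centredXi, hhalf]
    rw [hlog] at h
    have hre := (Complex.continuous_re.tendsto _).comp h
    rw [Complex.ofReal_re] at hre
    refine hre.congr fun R ↦ ?_
    rw [Function.comp_apply, Complex.re_sum, Finset.sum_map]
    refine Finset.sum_congr rfl fun ρ hρ ↦ ?_
    have hmem := ((hS R ρ).1 hρ).1
    have hρ' : 1 / 2 + (ρ + -(1 / 2)) = ρ := by ring
    rw [Set.indicator_of_mem hmem, addRightEmbedding_apply,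
      analyticOrderNatAt_centredXi (by rwa [hρ']), hρ',
      show (1 / 2 : ℂ) - (ρ + -(1 / 2)) = 1 - ρ by ring, ← re_one_div_one_sub,
      div_eq_mul_one_div, ← Complex.ofReal_natCast, Complex.re_ofReal_mul]

/-- The nontrivial zeros in the upper half plane. -/
def upperZeros : Set ℂ := {ρ | ρ ∈ nontrivialZeros ∧ 0 < ρ.im}

lemma one_sub_conj_mem_upperZeros_iff {ρ : ℂ} : 1 - conj ρ ∈ upperZeros ↔ ρ ∈ upperZeros := by
  have h : ∀ {ρ : ℂ}, ρ ∈ upperZeros → 1 - conj ρ ∈ upperZeros := fun hρ ↦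
    ⟨one_sub_mem_nontrivialZeros (conj_mem_nontrivialZeros hρ.1), by simpa using hρ.2⟩
  exact ⟨fun hρ ↦ by simpa using h hρ, h⟩

lemma zeroMult_one_sub_conj {ρ : ℂ} (hρ : ρ ∈ nontrivialZeros) :
    zeroMult (1 - conj ρ) = zeroMult ρ := by
  rw [zeroMult_one_sub (conj_mem_nontrivialZeros hρ), zeroMult_conj hρ]

/-- Reflection in the critical line. -/
noncomputable def reflectEquiv : ℂ ≃ ℂ where
  toFun ρ := 1 - conj ρ
  invFun ρ := 1 - conj ρ
  left_inv ρ := by simp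
  right_inv ρ := by simp

lemma hasSum_upperZeros_zeroTerm :
    HasSum (upperZeros.indicator fun ρ ↦ (zeroMult ρ : ℝ) * zeroTerm ρ)
      (thetaMellin 1 / 2) := by
  set u := nontrivialZeros.indicator fun ρ ↦ (zeroMult ρ : ℝ) * zeroTerm ρ
  set v := upperZeros.indicator fun ρ ↦ (zeroMult ρ : ℝ) * zeroTerm ρ
  have hv : v = {ρ : ℂ | 0 < ρ.im}.indicator u := by
    rw [Set.indicator_indicator]
    exact congrArg (Set.indicator · _) (Set.ext fun ρ ↦ and_comm)
  have hs : Summable v := hv ▸ hasSum_zeroTerm.summable.indicator _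
  have hconj : HasSum (fun ρ ↦ v (conj ρ)) (∑' ρ, v ρ) :=
    (Complex.conjAe.toEquiv.hasSum_iff (f := v)).2 hs.hasSum
  have hadd := hs.hasSum.add hconj
  have huv : (fun ρ ↦ v ρ + v (conj ρ)) = u := by
    funext ρ
    by_cases hρ : ρ ∈ nontrivialZeros
    · have hc := conj_mem_nontrivialZeros hρ
      rcases (im_ne_zero_of_mem_nontrivialZeros hρ).lt_or_gt with h | h
      · simp [u, v, upperZeros, hρ, hc, h, h.le, zeroTerm, zeroMult_conj hρ]
      · simp [u, v, upperZeros, hρ, hc, h, h.le, zeroTerm]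
    · have hc : conj ρ ∉ nontrivialZeros := fun hc ↦ hρ (by
        simpa using conj_mem_nontrivialZeros hc)
      simp [u, v, upperZeros, hρ, hc]
  rw [huv] at hadd
  have := hadd.unique hasSum_zeroTerm
  convert hs.hasSum using 1
  linarith

lemma half_muTerm_eq {ρ : ℂ} (hρ : ρ.im ≠ 0) :
    muTerm ρ / 2 = zeroTerm ρ + zeroTerm (1 - conj ρ) := by
  have h1 : 0 < (1 - ρ.re) ^ 2 + ρ.im ^ 2 := by positivity
  have h2 : 0 < ρ.re ^ 2 + ρ.im ^ 2 := by positivity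
  have e1 : 1 / 2 + (ρ.re - 1 / 2) = ρ.re := by ring
  have e2 : 1 / 2 - (ρ.re - 1 / 2) = 1 - ρ.re := by ring
  simp only [muTerm, zeroTerm, zeroDelta, zeroBeta, e1, e2, Complex.sub_re, Complex.sub_im,
    Complex.one_re, Complex.one_im, Complex.conj_re, Complex.conj_im, sub_sub_cancel, zero_sub,
    neg_neg]
  rw [div_add_div _ _ h1.ne' h2.ne', div_div, div_eq_div_iff (by positivity) (by positivity)]
  ring

lemma half_muTerm_eq_lambdaTerm {ρ : ℂ} (hδ : zeroDelta ρ = 0) :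
    muTerm ρ / 2 = lambdaTerm ρ := by
  have : 0 < (1 / 2 : ℝ) ^ 2 + zeroBeta ρ ^ 2 := by positivity
  rw [muTerm, lambdaTerm, hδ, add_zero, sub_zero, div_div, div_eq_div_iff (by positivity) this.ne']
  ring

/-- The sum over the zeros in the upper half plane, each paired with its reflection in the
critical line. -/
lemma hasSum_upperZeros_muTerm :
    HasSum (upperZeros.indicator fun ρ ↦ (zeroMult ρ : ℝ) * (muTerm ρ / 2))
      (thetaMellin 1) := by
  have h := hasSum_upperZeros_zeroTerm
  have h2 := h.add (reflectEquiv.hasSum_iff.2 h)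
  rw [add_halves] at h2
  convert h2 using 2 with ρ
  simp only [Function.comp_apply, reflectEquiv, Equiv.coe_fn_mk]
  by_cases hρ : ρ ∈ upperZeros
  · rw [Set.indicator_of_mem hρ, Set.indicator_of_mem hρ,
      Set.indicator_of_mem (one_sub_conj_mem_upperZeros_iff.2 hρ), zeroMult_one_sub_conj hρ.1,
      half_muTerm_eq hρ.2.ne', mul_add]
  · rw [Set.indicator_of_notMem hρ, Set.indicator_of_notMem hρ,
      Set.indicator_of_notMem (mt one_sub_conj_mem_upperZeros_iff.1 hρ), add_zero]

lemma muTerm_one_sub_conj (ρ : ℂ) : muTerm (1 - conj ρ) = muTerm ρ := by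
  simp only [muTerm, zeroDelta, zeroBeta, Complex.sub_re, Complex.sub_im, Complex.one_re,
    Complex.one_im, Complex.conj_re, Complex.conj_im, zero_sub, neg_neg]
  congr 1 <;> ring

theorem theorem2p4 :
    Summable (fun ρ : Omega1 => (zeroMult ρ : ℝ) * lambdaTerm ρ) ∧
    Summable (fun ρ : Omega2 => (zeroMult ρ : ℝ) * muTerm ρ) ∧
    lambdaSum + muSum =
      1 + Real.eulerMascheroniConstant / 2 - 1 / 2 * Real.log (4 * Real.pi) := by
  set k := upperZeros.indicator fun ρ ↦ (zeroMult ρ : ℝ) * (muTerm ρ / 2)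
  have hk : HasSum k (thetaMellin 1) := hasSum_upperZeros_muTerm
  have hsub1 : Omega1 ⊆ upperZeros := fun ρ h ↦ ⟨h.1, h.2.2⟩
  have hsub2 : Omega2 ⊆ upperZeros := fun ρ h ↦ ⟨h.1, h.2.2⟩
  set A := Omega1.indicator fun ρ ↦ (zeroMult ρ : ℝ) * lambdaTerm ρ
  set B := Omega2.indicator fun ρ ↦ (zeroMult ρ : ℝ) * muTerm ρ
  have hA : A = Omega1.indicator k := by
    refine Set.indicator_congr fun ρ h ↦ ?_
    simp only [k]
    rw [Set.indicator_of_mem (hsub1 h), half_muTerm_eq_lambdaTerm h.2.1]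
  have hB : B = Omega2.indicator fun ρ ↦ 2 * k ρ := by
    refine Set.indicator_congr fun ρ h ↦ ?_
    simp only [k]
    rw [Set.indicator_of_mem (hsub2 h)]
    ring
  have hsA : Summable A := hA ▸ hk.summable.indicator _
  have hsB : Summable B := hB ▸ (hk.summable.mul_left 2).indicator _
  refine ⟨summable_subtype_iff_indicator.2 hsA, summable_subtype_iff_indicator.2 hsB, ?_⟩
  have hlam : lambdaSum = ∑' ρ, A ρ :=
    tsum_subtype Omega1 fun ρ ↦ (zeroMult ρ : ℝ) * lambdaTerm ρ
  have hmu : muSum = ∑' ρ, B ρ :=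
    tsum_subtype Omega2 fun ρ ↦ (zeroMult ρ : ℝ) * muTerm ρ
  rw [hlam, hmu, ← thetaMellin_one]
  have hBr : HasSum (B ∘ reflectEquiv) (∑' ρ, B ρ) := reflectEquiv.hasSum_iff.2 hsB.hasSum
  have hsum := hsA.hasSum.add ((hsB.hasSum.add hBr).div_const 2)
  rw [add_self_div_two] at hsum
  refine hsum.unique ?_
  convert hk using 2 with ρ
  have hr : (B ∘ reflectEquiv) ρ = B (1 - conj ρ) := rfl
  rw [hr]
  by_cases hρ : ρ ∈ upperZeros
  · have hσ := one_sub_conj_mem_upperZeros_iff.2 hρ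
    have hδ : zeroDelta (1 - conj ρ) = -zeroDelta ρ := by
      simp [zeroDelta]; ring
    have m1 : ρ ∈ Omega1 ↔ zeroDelta ρ = 0 := ⟨fun h ↦ h.2.1, fun h ↦ ⟨hρ.1, h, hρ.2⟩⟩
    have m2 : ρ ∈ Omega2 ↔ 0 < zeroDelta ρ := ⟨fun h ↦ h.2.1, fun h ↦ ⟨hρ.1, h, hρ.2⟩⟩
    have m3 : 1 - conj ρ ∈ Omega2 ↔ zeroDelta ρ < 0 := by
      rw [← neg_pos, ← hδ]
      exact ⟨fun h ↦ h.2.1, fun h ↦ ⟨hσ.1, h, hσ.2⟩⟩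
    have hkρ : k ρ = (zeroMult ρ : ℝ) * (muTerm ρ / 2) := Set.indicator_of_mem hρ _
    have hB0 : ∀ {z}, z ∉ Omega2 → B z = 0 := fun h ↦ Set.indicator_of_notMem h _
    have hB1 : ∀ {z}, z ∈ Omega2 → B z = (zeroMult z : ℝ) * muTerm z :=
      fun h ↦ Set.indicator_of_mem h _
    rcases lt_trichotomy (zeroDelta ρ) 0 with h | h | h
    · have hAρ : A ρ = 0 := Set.indicator_of_notMem (fun h' ↦ h.ne (m1.1 h')) _
      rw [hkρ, hAρ, hB0 (fun h' ↦ h.not_gt (m2.1 h')), hB1 (m3.2 h),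
        zeroMult_one_sub_conj hρ.1, muTerm_one_sub_conj]
      ring
    · have hAρ : A ρ = (zeroMult ρ : ℝ) * lambdaTerm ρ := Set.indicator_of_mem (m1.2 h) _
      rw [hkρ, hAρ, hB0 (fun h' ↦ h.not_gt (m2.1 h')), hB0 (fun h' ↦ h.not_lt (m3.1 h')),
        half_muTerm_eq_lambdaTerm h]
      ring
    · have hAρ : A ρ = 0 := Set.indicator_of_notMem (fun h' ↦ h.ne' (m1.1 h')) _
      rw [hkρ, hAρ, hB1 (m2.2 h), hB0 (fun h' ↦ h.not_gt (m3.1 h'))]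
      ring
  · have hσ := mt one_sub_conj_mem_upperZeros_iff.1 hρ
    simp only [A, B, k, Set.indicator_of_notMem (fun h ↦ hρ (hsub1 h)),
      Set.indicator_of_notMem (fun h ↦ hρ (hsub2 h)),
      Set.indicator_of_notMem (fun h ↦ hσ (hsub2 h)), Set.indicator_of_notMem hρ]
    norm_num
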